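/- Let $\mathbb{S}_1=\{z\in\mathbb{C}:|z|=1\}$, and for $\mathbf z\in(\mathbb{C}^\times)^d$ put $\mathbf z^*=(\overline{z_1}^{\,-1},\dots,\overline{z_d}^{\,-1})$ and $U^*=\{\mathbf z^*:\mathbf z\in U\}$ for $U\subseteq(\mathbb{C}^\times)^d$. Let $V\subseteq\mathbb{C}^n$ be an irreducible algebraic variety of dimension $d$ whose projection to the first $d$ coordinates is dominant. Given an open set $U\subseteq(\mathbb{C}^\times)^d$ and a holomorphic map $F=(f_1,\dots,f_{n-d}):U\to\mathbb{C}^{n-d}$, consider the conditions (i) $(\mathbf z,F(\mathbf z))\in V$ for all $\mathbf z\in U$; (ii) $\overline{f_k(\mathbf z)}\cdot f_k(\mathbf z^*)=1$ for all $\mathbf z\in U\cap U^*$ and all $k=1,\dots,n-d$. Then $V\cap\mathbb{S}_1^n$ is Zariski dense in $V$ if and only if there are an open set $U\subseteq(\mathbb{C}^\times)^d$ with $U\cap\mathbb{S}_1^d\neq\emptyset$ and a holomorphic map $F:U\to\mathbb{C}^{n-d}$ satisfying (i) and (ii). Moreover, every holomorphic map $F$ on an open set $U\subseteq(\mathbb{C}^\times)^d$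 (whether or not $U$ meets $\mathbb{S}_1^d$) satisfying (i) and (ii) is algebraic: for each $k$ there is a non-zero polynomial $p_k\in\mathbb{C}[z_1,\dots,z_d,w]$ with $p_k(\mathbf z,f_k(\mathbf z))=0$ for all $\mathbf z\in U$. -/

import Mathlib

open scoped ComplexConjugate

/-- `V ⊆ ℂⁿ` is an algebraic variety: the set of common zeros of an ideal of polynomials
(equivalently, by Hilbert's basis theorem, of a finite list of polynomials). -/
def IsVariety {n : ℕ} (V : Set (Fin n → ℂ)) : Prop :=
  ∃ I : Ideal (MvPolynomial (Fin n) ℂ), V = MvPolynomial.zeroLocus ℂ I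

/-- A (non-empty) variety that is not the union of two properly contained varieties. -/
def IsIrreducibleVariety {n : ℕ} (V : Set (Fin n → ℂ)) : Prop :=
  IsVariety V ∧ V.Nonempty ∧
    ∀ V₁ V₂ : Set (Fin n → ℂ), IsVariety V₁ → IsVariety V₂ → V = V₁ ∪ V₂ → V = V₁ ∨ V = V₂

/-- `A` is a subset of `V`, and every polynomial vanishing on `A` vanishes on `V`. -/
def ZariskiDenseIn {n : ℕ} (A V : Set (Fin n → ℂ)) : Prop :=
  A ⊆ V ∧ ∀ p : MvPolynomial (Fin n) ℂ,
    (∀ z ∈ A, MvPolynomial.eval z p = 0) → ∀ z ∈ V, MvPolynomial.eval z p = 0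

/-- The complex dimension of `V ⊆ ℂⁿ` is `d`: the largest `e` for which the projection of `V`
to some `e` coordinates contains a non-empty (Euclidean) open subset of `ℂᵉ`. -/
def HasComplexDim {n : ℕ} (V : Set (Fin n → ℂ)) (d : ℕ) : Prop :=
  IsGreatest {e : ℕ | ∃ k : Fin e ↪ Fin n,
    (interior ((fun (z : Fin n → ℂ) (i : Fin e) => z (k i)) '' V)).Nonempty} d

/-- The projection `ℂ^(d+m) → ℂ^d` to the first `d` coordinates. -/
def projFirst (d m : ℕ) (z : Fin (d + m) → ℂ) : Fin d → ℂ :=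
  fun i => z (Fin.castAdd m i)

/-- The projection of `V` to the first `d` coordinates is dominant: its image has dimension `d`. -/
def ProjFirstDominant (d m : ℕ) (V : Set (Fin (d + m) → ℂ)) : Prop :=
  HasComplexDim (projFirst d m '' V) d

/-- The torus `𝕊₁ⁿ ⊆ ℂⁿ`. -/
def unitTorus (n : ℕ) : Set (Fin n → ℂ) := {z | ∀ i, ‖z i‖ = 1}

/-- The set `(ℂˣ)ⁿ ⊆ ℂⁿ`. -/
def puncturedSpace (n : ℕ) : Set (Fin n → ℂ) := {z | ∀ i, z i ≠ 0}

/-- The map `z ↦ z*`, the coordinatewise inverse of the complex conjugate. -/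
noncomputable def conjInv {n : ℕ} (z : Fin n → ℂ) : Fin n → ℂ := fun i => (conj (z i))⁻¹

/-- `F` is holomorphic on the open set `U ⊆ (ℂˣ)^d`, its graph over `U` is contained in `V`, and
`conj (f_k z) * f_k (z*) = 1` for all `z ∈ U ∩ U*` and all `k`. -/
structure IsReflectiveGraphMap {d m : ℕ} (V : Set (Fin (d + m) → ℂ)) (U : Set (Fin d → ℂ))
    (F : (Fin d → ℂ) → (Fin m → ℂ)) : Prop where
  isOpen : IsOpen U
  subset_punctured : U ⊆ puncturedSpace d
  holomorphic : DifferentiableOn ℂ F U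
  graph_subset : ∀ z ∈ U, Fin.append z (F z) ∈ V
  reflection : ∀ z ∈ U ∩ conjInv '' U, ∀ k : Fin m, conj (F z k) * F (conjInv z) k = 1

/-- The holomorphic function `f` on `U ⊆ ℂ^d` is algebraic: `p (z, f z) = 0` on `U` for some
non-zero polynomial `p` in `d + 1` variables. -/
def IsAlgebraicFunOn {d : ℕ} (U : Set (Fin d → ℂ)) (f : (Fin d → ℂ) → ℂ) : Prop :=
  DifferentiableOn ℂ f U ∧ ∃ p : MvPolynomial (Fin (d + 1)) ℂ, p ≠ 0 ∧
    ∀ z ∈ U, MvPolynomial.eval (Fin.snoc (α := fun _ => ℂ) z (f z)) p = 0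

/-! Let `I` be the prime ideal of `V`. Dominance says that the first `d` coordinates are independent
modulo `I`; dimension `d` makes every other coordinate algebraic over them
(`HasComplexDim.exists_rename_snoc_mem`), which already gives the algebraicity of `F`. A primitive
element then makes `V` birational to a hypersurface `P(z, w) = 0`, and where `w` is a simple root
the implicit function theorem shows that `V` is locally the graph of a unique holomorphic map
(`exists_local_graph`).

If the torus points are dense, `V` is stable under `z ↦ z*` off the coordinate hyperplanes
(`ZariskiDenseIn.conjInv_mem`), since `*` fixes the torus pointwise and preserves polynomial
equations. Some torus point avoids the bad locus; the reflection of the graph there lies in `V` too,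
so uniqueness gives the reflection identity.

Conversely, the identity puts the graph over torus points in the torus. A polynomial vanishing on `V
∩ 𝕊₁ⁿ` then vanishes on the graph over a polydisc (`eq_zero_of_forall_mem_unitTorus`), hence on `V`
(`exists_rename_sub_mul_mem`). -/

/-! ### Commutative algebra: dominant morphisms and primitive elements -/

open MvPolynomial in
/-- A dominant morphism of affine varieties contains a non-empty basic open set in its image. -/
theorem exists_ne_zero_forall_exists_mem_zeroLocus {σ τ : Type*} [Finite σ] [Finite τ]
    (I : Ideal (MvPolynomial σ ℂ)) [I.IsPrime] (k : τ → σ)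
    (hI : ∀ r : MvPolynomial τ ℂ, rename k r ∈ I → r = 0) :
    ∃ r : MvPolynomial τ ℂ, r ≠ 0 ∧ ∀ z : τ → ℂ, eval z r ≠ 0 →
      ∃ x ∈ zeroLocus ℂ I, x ∘ k = z := by
  let g : MvPolynomial τ ℂ →+* MvPolynomial σ ℂ := (rename k).toRingHom
  let f : MvPolynomial τ ℂ →+* MvPolynomial σ ℂ ⧸ I := (Ideal.Quotient.mk I).comp g
  have hfinj : Function.Injective f := by
    rw [injective_iff_map_eq_zero]
    intro r hr
    exact hI r (Ideal.Quotient.eq_zero_iff_mem.mp hr)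
  have hft : f.FiniteType := by
    refine RingHom.FiniteType.of_comp_finiteType (f := MvPolynomial.C) ?_
    have : f.comp C = algebraMap ℂ (MvPolynomial σ ℂ ⧸ I) := by
      ext c
      simp [f, g]
      rfl
    rw [this, RingHom.finiteType_algebraMap]
    infer_instance
  have hfp : f.FinitePresentation := RingHom.FinitePresentation.of_finiteType.mp hft
  obtain ⟨S, hS⟩ := PrimeSpectrum.exists_constructibleSetData_iff.mpr
    (PrimeSpectrum.isConstructible_range_comap hfp)
  -- By Chevalley the image is constructible. The piece containing the generic point has only zero
  -- equations, so it is the basic open set of `c.f ≠ 0`.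
  have hbot : (⊥ : PrimeSpectrum (MvPolynomial τ ℂ)) ∈ S.toSet := by
    rw [hS]
    refine ⟨⊥, PrimeSpectrum.ext ?_⟩
    exact Ideal.comap_bot_of_injective f hfinj
  simp only [PrimeSpectrum.ConstructibleSetData.toSet, Set.mem_iUnion] at hbot
  obtain ⟨c, hc, hmem⟩ := hbot
  have hmem1 : ∀ i, c.g i = 0 := fun i => by
    have := hmem.1 ⟨i, rfl⟩
    exact this
  have hmem2 : c.f ≠ 0 := fun h => hmem.2 (by
    rintro _ rfl
    exact h)
  refine ⟨c.f, hmem2, fun z hz => ?_⟩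
  let p : PrimeSpectrum (MvPolynomial τ ℂ) := pointToPoint z
  have hpmem : p ∈ Set.range (PrimeSpectrum.comap f) := by
    rw [← hS]
    simp only [PrimeSpectrum.ConstructibleSetData.toSet, Set.mem_iUnion]
    refine ⟨c, hc, ?_, ?_⟩
    · rintro _ ⟨i, rfl⟩
      simp [hmem1 i]
    · intro h
      have h1 : c.f ∈ vanishingIdeal ℂ {z} := h rfl
      rw [mem_vanishingIdeal_singleton_iff] at h1
      exact hz (by simpa using h1)
  obtain ⟨q, hq⟩ := hpmem
  -- Any maximal ideal above `q` still contains the elements `X t - z t`; by the Nullstellensatz it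
  -- is a point of the fibre.
  obtain ⟨M, hM, hqM⟩ := Ideal.exists_le_maximal q.asIdeal q.2.ne_top
  have hM' : (M.comap (Ideal.Quotient.mk I)).IsMaximal :=
    Ideal.comap_isMaximal_of_surjective _ Ideal.Quotient.mk_surjective
  obtain ⟨x, hx⟩ := isMaximal_iff_eq_vanishingIdeal_singleton.mp hM'
  refine ⟨x, ?_, ?_⟩
  · intro r hr
    rw [← mem_vanishingIdeal_singleton_iff, ← hx, Ideal.mem_comap,
      Ideal.Quotient.eq_zero_iff_mem.mpr hr]
    exact zero_mem _
  · funext t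
    have h1 : (X t - C (z t) : MvPolynomial τ ℂ) ∈ p.asIdeal := by
      change _ ∈ vanishingIdeal ℂ {z}
      rw [mem_vanishingIdeal_singleton_iff]
      simp
    rw [← hq] at h1
    have h2 : g (X t - C (z t)) ∈ M.comap (Ideal.Quotient.mk I) := hqM h1
    rw [hx, mem_vanishingIdeal_singleton_iff] at h2
    simpa [g, sub_eq_zero] using h2

open Polynomial in
/-- A domain that is algebraic and of finite type over an integrally closed domain of
characteristic zero has the same fractions as a monogenic integral subalgebra. -/
theorem exists_isIntegral_forall_smul_eq_aeval {R A : Type*} [CommRing R] [IsDomain R] [CharZero R]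
    [CommRing A] [IsDomain A] [Algebra R A] [FaithfulSMul R A] [Algebra.FiniteType R A]
    [Algebra.IsAlgebraic R A] :
    ∃ w : A, IsIntegral R w ∧ ∀ a : A, ∃ b : R, b ≠ 0 ∧ ∃ q : R[X], algebraMap R A b * a = aeval w q := by
  let K := FractionRing R
  let L := FractionRing A
  let _ : Algebra K L := FractionRing.liftAlgebra R L
  have : Algebra.IsAlgebraic K L :=
    (IsFractionRing.comap_isAlgebraic_iff (A := R) (K := K) (C := L)).mp
      ((IsFractionRing.isAlgebraic_iff' R A L).mp inferInstance)
  have : Module.Finite K L := by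
    have : Algebra.EssFiniteType R L := Algebra.EssFiniteType.comp R A L
    have : Algebra.EssFiniteType K L := Algebra.EssFiniteType.of_comp R K L
    exact Algebra.finite_of_essFiniteType_of_isAlgebraic
  have : CharZero K := charZero_of_injective_algebraMap (IsFractionRing.injective R K)
  obtain ⟨α, hα⟩ := Field.exists_primitive_element K L
  -- By algebraicity, denominators can be taken in `R`: `α = u / v`. Then `r • u = r v α` is
  -- integral and still primitive.
  obtain ⟨⟨u, v⟩, huv⟩ := IsLocalization.surj (Algebra.algebraMapSubmonoid A (nonZeroDivisors R)) α
  obtain ⟨_, v, hv, rfl⟩ := v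
  have hv0 : v ≠ 0 := nonZeroDivisors.ne_zero hv
  obtain ⟨r, hr0, hr⟩ := IsAlgebraic.exists_integral_multiple (Algebra.IsAlgebraic.isAlgebraic (R := R) u)
  have hKinj : Function.Injective (algebraMap R K) := IsFractionRing.injective R K
  have hw : algebraMap A L (r • u) = algebraMap R K (r * v) • α := by
    rw [Algebra.smul_def, Algebra.smul_def, map_mul, ← huv, map_mul (algebraMap R K), map_mul,
      ← IsScalarTower.algebraMap_apply, ← IsScalarTower.algebraMap_apply,
      ← IsScalarTower.algebraMap_apply, ← IsScalarTower.algebraMap_apply]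
    ring
  have hc : algebraMap R K (r * v) ≠ 0 := by
    rw [Ne, map_eq_zero_iff _ hKinj]
    exact mul_ne_zero hr0 hv0
  refine ⟨r • u, hr, fun a => ?_⟩
  have htop : Algebra.adjoin K {algebraMap A L (r • u)} = ⊤ := by
    rw [← IntermediateField.adjoin_simple_eq_top_iff_of_isAlgebraic (Algebra.IsAlgebraic.isAlgebraic _),
      eq_top_iff, ← hα, IntermediateField.adjoin_simple_le_iff]
    have h1 : α = (algebraMap R K (r * v))⁻¹ • algebraMap A L (r • u) := by
      rw [hw, smul_smul, inv_mul_cancel₀ hc, one_smul]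
    rw [h1]
    exact IntermediateField.smul_mem _ (IntermediateField.mem_adjoin_simple_self _ _)
  have ha : algebraMap A L a ∈ Algebra.adjoin K {algebraMap A L (r • u)} := htop ▸ trivial
  rw [Algebra.adjoin_singleton_eq_range_aeval] at ha
  obtain ⟨q, hq⟩ := ha
  obtain ⟨b, hb, hbq⟩ := IsLocalization.integerNormalization_spec (nonZeroDivisors R) q
  refine ⟨b, nonZeroDivisors.ne_zero hb, IsLocalization.integerNormalization (nonZeroDivisors R) q,
    IsFractionRing.injective A L ?_⟩
  rw [← aeval_algebraMap_apply, ← aeval_map_algebraMap K, hbq, ← algebraMap_smul K b q, map_smul,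
    Algebra.smul_def, map_mul, ← IsScalarTower.algebraMap_apply R K L,
    ← IsScalarTower.algebraMap_apply R A L]
  congr 1
  exact hq.symm

/-- The coordinate ring of an affine variety as an algebra over the polynomials in the first
coordinates. -/
noncomputable abbrev firstCoordsAlgebra {d m : ℕ} (I : Ideal (MvPolynomial (Fin (d + m)) ℂ)) :
    Algebra (MvPolynomial (Fin d) ℂ) (MvPolynomial (Fin (d + m)) ℂ ⧸ I) :=
  ((Ideal.Quotient.mk I).comp
    (MvPolynomial.rename (Fin.castAdd m) : _ →ₐ[ℂ] _).toRingHom).toAlgebra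

/-! ### Varieties generically finite over the first coordinates -/

section GenericallyFinite

open MvPolynomial

variable {d m : ℕ} {I : Ideal (MvPolynomial (Fin (d + m)) ℂ)}

theorem firstCoords_algebraMap_apply (r : MvPolynomial (Fin d) ℂ) :
    let _ := firstCoordsAlgebra I
    algebraMap (MvPolynomial (Fin d) ℂ) (MvPolynomial (Fin (d + m)) ℂ ⧸ I) r =
      Ideal.Quotient.mk I (rename (Fin.castAdd m) r) :=
  rfl

theorem firstCoords_aeval_mk (w : MvPolynomial (Fin (d + m)) ℂ)
    (q : Polynomial (MvPolynomial (Fin d) ℂ)) :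
    let _ := firstCoordsAlgebra I
    Polynomial.aeval (Ideal.Quotient.mk I w) q =
      Ideal.Quotient.mk I (q.eval₂ (rename (Fin.castAdd m) : _ →ₐ[ℂ] _).toRingHom w) := by
  rw [Polynomial.hom_eval₂]
  rfl

theorem isAlgebraic_firstCoords [I.IsPrime]
    (hI : ∀ k : Fin m, ∃ p : MvPolynomial (Fin (d + 1)) ℂ, p ≠ 0 ∧
      rename (Fin.snoc (α := fun _ => Fin (d + m)) (Fin.castAdd m) (Fin.natAdd d k)) p ∈ I) :
    let _ := firstCoordsAlgebra I
    Algebra.IsAlgebraic (MvPolynomial (Fin d) ℂ) (MvPolynomial (Fin (d + m)) ℂ ⧸ I) := by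
  let _ := firstCoordsAlgebra I
  refine ⟨fun a => ?_⟩
  obtain ⟨a, rfl⟩ := Ideal.Quotient.mk_surjective a
  induction a using MvPolynomial.induction_on with
  | C c =>
    rw [← MvPolynomial.rename_C (Fin.castAdd m), ← firstCoords_algebraMap_apply]
    exact isAlgebraic_algebraMap _
  | add p q hp hq => exact map_add (Ideal.Quotient.mk I) p q ▸ hp.add hq
  | mul_X p i hp =>
    rw [map_mul]
    refine hp.mul ?_
    induction i using Fin.addCases with
    | left i =>
      rw [← MvPolynomial.rename_X (Fin.castAdd m), ← firstCoords_algebraMap_apply]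
      exact isAlgebraic_algebraMap _
    | right k =>
      obtain ⟨p, hp0, hpI⟩ := hI k
      let e : MvPolynomial (Fin (d + 1)) ℂ ≃ₐ[ℂ] Polynomial (MvPolynomial (Fin d) ℂ) :=
        (renameEquiv ℂ finSuccEquivLast).trans (optionEquivLeft ℂ (Fin d))
      refine ⟨e p, by simpa using hp0, ?_⟩
      rw [firstCoords_aeval_mk, Ideal.Quotient.eq_zero_iff_mem]
      convert hpI using 1
      let g : Polynomial (MvPolynomial (Fin d) ℂ) →+* MvPolynomial (Fin (d + m)) ℂ :=
        Polynomial.eval₂RingHom (rename (Fin.castAdd m) : _ →ₐ[ℂ] _).toRingHom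
          (X (Fin.natAdd d k))
      change (g.comp (e : _ →+* _)) p = (rename _ : _ →ₐ[ℂ] _).toRingHom p
      congr 1
      refine MvPolynomial.ringHom_ext (fun c => ?_) (fun i => ?_)
      · simp [g, e]
      · induction i using Fin.lastCases with
        | last => simp [g, e]
        | cast i => simp [g, e]

/-- A nonzero element of a domain algebraic over a subring divides a nonzero element of that
subring. -/
theorem exists_rename_sub_mul_mem [I.IsPrime]
    (hI : ∀ k : Fin m, ∃ p : MvPolynomial (Fin (d + 1)) ℂ, p ≠ 0 ∧
      rename (Fin.snoc (α := fun _ => Fin (d + m)) (Fin.castAdd m) (Fin.natAdd d k)) p ∈ I)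
    {s : MvPolynomial (Fin (d + m)) ℂ} (hs : s ∉ I) :
    ∃ r : MvPolynomial (Fin d) ℂ, r ≠ 0 ∧ ∃ t, rename (Fin.castAdd m) r - s * t ∈ I := by
  let _ := firstCoordsAlgebra I
  have := isAlgebraic_firstCoords hI
  obtain ⟨r, hr, t, ht⟩ :=
    (Algebra.IsAlgebraic.isAlgebraic (R := MvPolynomial (Fin d) ℂ)
      (Ideal.Quotient.mk I s)).exists_nonzero_dvd
      (mem_nonZeroDivisors_of_ne_zero (Ideal.Quotient.eq_zero_iff_mem.not.mpr hs))
  obtain ⟨t, rfl⟩ := Ideal.Quotient.mk_surjective t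
  refine ⟨r, hr, t, ?_⟩
  rw [← Ideal.Quotient.eq_zero_iff_mem, map_sub, map_mul, ← ht, ← firstCoords_algebraMap_apply,
    sub_self]

/-- A variety that is generically finite over the first `d` coordinates is generically the graph
of a tuple of rational functions over a hypersurface. -/
theorem exists_generic_hypersurface [I.IsPrime]
    (hinj : ∀ r : MvPolynomial (Fin d) ℂ, rename (Fin.castAdd m) r ∈ I → r = 0)
    (hI : ∀ k : Fin m, ∃ p : MvPolynomial (Fin (d + 1)) ℂ, p ≠ 0 ∧
      rename (Fin.snoc (α := fun _ => Fin (d + m)) (Fin.castAdd m) (Fin.natAdd d k)) p ∈ I) :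
    ∃ (w : MvPolynomial (Fin (d + m)) ℂ) (P : Polynomial (MvPolynomial (Fin d) ℂ))
      (b : MvPolynomial (Fin d) ℂ) (q : Fin m → Polynomial (MvPolynomial (Fin d) ℂ)),
      rename (Fin.castAdd m) b *
        P.derivative.eval₂ (rename (Fin.castAdd m) : _ →ₐ[ℂ] _).toRingHom w ∉ I ∧
      P.eval₂ (rename (Fin.castAdd m) : _ →ₐ[ℂ] _).toRingHom w ∈ I ∧
      (∀ k, rename (Fin.castAdd m) b * X (Fin.natAdd d k) -
        (q k).eval₂ (rename (Fin.castAdd m) : _ →ₐ[ℂ] _).toRingHom w ∈ I) ∧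
      ∀ (z : Fin d → ℂ) (y : ℂ), eval z b ≠ 0 → P.eval₂ (eval z) y = 0 →
        Fin.append z (fun k => (q k).eval₂ (eval z) y / eval z b) ∈ zeroLocus ℂ I := by
  let _ := firstCoordsAlgebra I
  have halg := isAlgebraic_firstCoords hI
  have hfaith : FaithfulSMul (MvPolynomial (Fin d) ℂ) (MvPolynomial (Fin (d + m)) ℂ ⧸ I) := by
    rw [faithfulSMul_iff_algebraMap_injective, injective_iff_map_eq_zero]
    intro r hr
    exact hinj r (Ideal.Quotient.eq_zero_iff_mem.mp hr)
  have htower : IsScalarTower ℂ (MvPolynomial (Fin d) ℂ) (MvPolynomial (Fin (d + m)) ℂ ⧸ I) :=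
    IsScalarTower.of_algebraMap_eq fun c => by
      rw [firstCoords_algebraMap_apply, MvPolynomial.algebraMap_eq, rename_C]
      rfl
  have hft : Algebra.FiniteType (MvPolynomial (Fin d) ℂ) (MvPolynomial (Fin (d + m)) ℂ ⧸ I) :=
    Algebra.FiniteType.of_restrictScalars_finiteType ℂ _ _
  obtain ⟨w, hw, hwa⟩ := exists_isIntegral_forall_smul_eq_aeval
    (R := MvPolynomial (Fin d) ℂ) (A := MvPolynomial (Fin (d + m)) ℂ ⧸ I)
  choose b hb0 q hq using fun k : Fin m => hwa (Ideal.Quotient.mk I (X (Fin.natAdd d k)))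
  set P := minpoly (MvPolynomial (Fin d) ℂ) w with hP
  -- The base is integrally closed, so `P` divides every polynomial killing `w`; `P.derivative` has
  -- smaller degree and is nonzero in characteristic zero.
  have hder : Polynomial.aeval w P.derivative ≠ 0 := by
    intro h
    have h1 : P.derivative = 0 := by
      by_contra h0
      have hdvd := minpoly.isIntegrallyClosed_dvd hw h
      exact absurd (Polynomial.degree_le_of_dvd hdvd h0) (not_le.mpr
        (Polynomial.degree_derivative_lt (minpoly.ne_zero hw)))
    have h2 := Polynomial.derivative_eq_zero.mp h1
    exact (minpoly.natDegree_pos hw).ne' h2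
  obtain ⟨w, rfl⟩ := Ideal.Quotient.mk_surjective w
  let B := ∏ k, b k
  have hB0 : B ≠ 0 := Finset.prod_ne_zero_iff.mpr fun k _ => hb0 k
  let Q : Fin m → Polynomial (MvPolynomial (Fin d) ℂ) := fun k =>
    Polynomial.C (∏ j ∈ Finset.univ.erase k, b j) * q k
  have hQ : ∀ k, algebraMap _ (MvPolynomial (Fin (d + m)) ℂ ⧸ I) B *
      Ideal.Quotient.mk I (X (Fin.natAdd d k)) =
      Polynomial.aeval (Ideal.Quotient.mk I w) (Q k) := fun k => by
    rw [map_mul, ← hq, Polynomial.aeval_C, ← mul_assoc, ← map_mul,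
      Finset.prod_erase_mul _ _ (Finset.mem_univ k)]
  refine ⟨w, P, B, Q, ?_, ?_, ?_, ?_⟩
  · rw [← Ideal.Quotient.eq_zero_iff_mem, map_mul, ← firstCoords_aeval_mk,
      ← firstCoords_algebraMap_apply]
    exact mul_ne_zero ((map_ne_zero_iff _ (FaithfulSMul.algebraMap_injective _ _)).mpr hB0) hder
  · rw [← Ideal.Quotient.eq_zero_iff_mem, ← firstCoords_aeval_mk]
    exact minpoly.aeval _ _
  · intro k
    rw [← Ideal.Quotient.eq_zero_iff_mem, map_sub, ← firstCoords_aeval_mk, ← hQ, map_mul,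
      ← firstCoords_algebraMap_apply, sub_self]
  · intro z y hz hy s hs
    obtain ⟨x, hx⟩ : ∃ x, x = Fin.append z fun k => (Q k).eval₂ (eval z) y / eval z B := ⟨_, rfl⟩
    rw [← hx]
    have hxl : ∀ i, x (Fin.castAdd m i) = z i := fun i => by rw [hx, Fin.append_left]
    have hxr : ∀ k, eval z B * x (Fin.natAdd d k) = (Q k).eval₂ (eval z) y := fun k => by
      rw [hx, Fin.append_right, mul_div_cancel₀ _ hz]
    -- One `S` represents `B ^ N * s` both modulo `I` and at the candidate point. For `s ∈ I` it
    -- kills `w`, so `P` divides it and it vanishes at `(z, y)`.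
    have key : ∀ s : MvPolynomial (Fin (d + m)) ℂ, ∃ (N : ℕ)
        (S : Polynomial (MvPolynomial (Fin d) ℂ)),
        algebraMap _ (MvPolynomial (Fin (d + m)) ℂ ⧸ I) B ^ N * Ideal.Quotient.mk I s =
          Polynomial.aeval (Ideal.Quotient.mk I w) S ∧
        eval z B ^ N * eval x s = S.eval₂ (eval z) y := by
      clear_value B Q P
      intro s
      induction s using MvPolynomial.induction_on with
      | C c =>
        refine ⟨0, Polynomial.C (C c), ?_, ?_⟩
        · rw [Polynomial.aeval_C, firstCoords_algebraMap_apply _ , firstCoords_algebraMap_apply,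
            rename_C, pow_zero, one_mul]
        · rw [Polynomial.eval₂_C, eval_C, eval_C, pow_zero, one_mul]
      | add p q hp hq =>
        obtain ⟨N, S, hS, hS'⟩ := hp
        obtain ⟨M, T, hT, hT'⟩ := hq
        refine ⟨N + M, Polynomial.C (B ^ M) * S + Polynomial.C (B ^ N) * T, ?_, ?_⟩
        · rw [map_add, map_add, map_mul, map_mul, ← hS, ← hT, Polynomial.aeval_C,
            Polynomial.aeval_C, map_pow, map_pow]
          ring
        · rw [Polynomial.eval₂_add, Polynomial.eval₂_mul, Polynomial.eval₂_mul, Polynomial.eval₂_C,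
            Polynomial.eval₂_C, ← hS', ← hT', map_add, map_pow, map_pow]
          ring
      | mul_X p i hp =>
        obtain ⟨N, S, hS, hS'⟩ := hp
        induction i using Fin.addCases with
        | left i =>
          refine ⟨N, S * Polynomial.C (X i), ?_, ?_⟩
          · rw [map_mul, map_mul, ← hS, Polynomial.aeval_C, firstCoords_algebraMap_apply (X i),
              rename_X, mul_assoc]
          · rw [Polynomial.eval₂_mul, Polynomial.eval₂_C, ← hS', map_mul, eval_X, eval_X, hxl,
              mul_assoc]
        | right k =>
          refine ⟨N + 1, S * Q k, ?_, ?_⟩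
          · rw [map_mul, map_mul, ← hS, ← hQ]
            ring
          · rw [Polynomial.eval₂_mul, ← hS', map_mul, eval_X, ← hxr]
            ring
    obtain ⟨N, S, hS, hS'⟩ := key s
    rw [Ideal.Quotient.eq_zero_iff_mem.mpr hs, mul_zero] at hS
    obtain ⟨T, rfl⟩ := minpoly.isIntegrallyClosed_dvd hw hS.symm
    rw [Polynomial.eval₂_mul, ← hP, hy, zero_mul] at hS'
    exact (mul_eq_zero.mp hS').resolve_left (pow_ne_zero _ hz)

end GenericallyFinite

/-! ### Holomorphic functions near the torus and simple roots -/

open Filter Topology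

theorem MvPolynomial.contDiff_eval {σ : Type*} [Fintype σ] {n : WithTop ℕ∞}
    (p : MvPolynomial σ ℂ) : ContDiff ℂ n fun z : σ → ℂ => eval z p := by
  induction p using MvPolynomial.induction_on with
  | C c => simpa using contDiff_const
  | add p q hp hq => simpa using hp.add hq
  | mul_X p i hp => simpa using hp.mul (contDiff_apply ℂ ℂ i)

theorem MvPolynomial.eq_zero_of_forall_mem_isOpen {σ : Type*} [Finite σ] (p : MvPolynomial σ ℂ)
    {U : Set (σ → ℂ)} (hU : IsOpen U) (hne : U.Nonempty) (hp : ∀ z ∈ U, eval z p = 0) : p = 0 := by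
  cases nonempty_fintype σ
  obtain ⟨z, hz⟩ := hne
  obtain ⟨ε, hε, hball⟩ := Metric.isOpen_iff.mp hU z hz
  refine MvPolynomial.funext_set (fun i => Metric.ball (z i) ε)
    (fun i => infinite_of_mem_nhds (z i) (Metric.ball_mem_nhds _ hε)) fun x hx => ?_
  rw [hp x (hball ?_), map_zero]
  rwa [ball_pi z hε]

theorem Complex.frequently_norm_eq_one {a : ℂ} (ha : ‖a‖ = 1) : ∃ᶠ t in 𝓝[≠] a, ‖t‖ = 1 := by
  have h : IsPreconnected (Metric.sphere (0 : ℂ) 1) :=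
    isPreconnected_sphere (by simp) 0 1
  have hnt : (Metric.sphere (0 : ℂ) 1).Nontrivial :=
    ⟨1, by simp, -1, by simp, by norm_num [Complex.ext_iff]⟩
  simpa using accPt_iff_frequently_nhdsNE.mp
    (h.preperfect_of_nontrivial hnt a (by simpa using ha))

/-- A holomorphic function on a polydisc centred on the unit torus is determined by its values on
the unit torus. -/
theorem eq_zero_of_forall_mem_unitTorus {d : ℕ} {g : (Fin d → ℂ) → ℂ} {z₀ : Fin d → ℂ} {ε : ℝ}
    (hz₀ : z₀ ∈ unitTorus d) (hg : DifferentiableOn ℂ g (Metric.ball z₀ ε))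
    (h : ∀ z ∈ Metric.ball z₀ ε ∩ unitTorus d, g z = 0) : ∀ z ∈ Metric.ball z₀ ε, g z = 0 := by
  rcases le_or_gt ε 0 with hε | hε
  · simp [Metric.ball_eq_empty.mpr hε]
  -- Coordinates are freed from the unit circle one at a time, by the one-variable identity theorem
  -- at `z₀ i`, where the circle accumulates.
  suffices key : ∀ (s : Finset (Fin d)) (z : Fin d → ℂ), z ∈ Metric.ball z₀ ε →
      (∀ i ∉ s, ‖z i‖ = 1) → g z = 0 from
    fun z hz => key Finset.univ z hz fun i hi => absurd (Finset.mem_univ i) hi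
  intro s
  induction s using Finset.induction_on with
  | empty => exact fun z hz hz1 => h z ⟨hz, fun i => hz1 i (Finset.notMem_empty i)⟩
  | insert i s _ ih =>
    intro z hz hz1
    have hmem : ∀ t ∈ Metric.ball (z₀ i) ε, Function.update z i t ∈ Metric.ball z₀ ε := by
      intro t ht
      rw [ball_pi z₀ hε] at hz ⊢
      intro j hj
      by_cases hji : j = i
      · subst hji
        simpa using ht
      · simpa [hji] using hz j hj
    have hdiff : DifferentiableOn ℂ (fun t => g (Function.update z i t))
        (Metric.ball (z₀ i) ε) :=
      hg.comp (fun t _ => (hasDerivAt_update z i t).differentiableAt.differentiableWithinAt) hmem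
    have hz0 : z i ∈ Metric.ball (z₀ i) ε := by
      rw [ball_pi z₀ hε] at hz
      exact hz i trivial
    have := (hdiff.analyticOnNhd Metric.isOpen_ball).eqOn_zero_of_preconnected_of_frequently_eq_zero
      (convex_ball _ _).isPreconnected (Metric.mem_ball_self hε) ?_ hz0
    · simpa using this
    · have hev : ∀ᶠ t in 𝓝[≠] (z₀ i), t ∈ Metric.ball (z₀ i) ε :=
        nhdsWithin_le_nhds (Metric.ball_mem_nhds _ hε)
      refine ((Complex.frequently_norm_eq_one (hz₀ i)).and_eventually hev).mono fun t ht => ?_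
      refine ih _ (hmem t ht.2) fun j hj => ?_
      by_cases hji : j = i
      · subst hji
        simpa using ht.1
      · simpa [hji] using hz1 j (by simp [hji, hj])

/-- The implicit function theorem at a simple root. Its uniqueness clause is what later identifies a
branch with its reflection. -/
theorem exists_local_root {d : ℕ} (P : Polynomial (MvPolynomial (Fin d) ℂ)) {z₀ : Fin d → ℂ}
    {y₀ : ℂ} (h₀ : P.eval₂ (MvPolynomial.eval z₀) y₀ = 0)
    (h₁ : P.derivative.eval₂ (MvPolynomial.eval z₀) y₀ ≠ 0) :
    ∃ f : (Fin d → ℂ) → ℂ, f z₀ = y₀ ∧ ContDiffAt ℂ 1 f z₀ ∧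
      (∀ᶠ z in 𝓝 z₀, P.eval₂ (MvPolynomial.eval z) (f z) = 0) ∧
      ∀ᶠ v in 𝓝 (z₀, y₀), P.eval₂ (MvPolynomial.eval v.1) v.2 = 0 → f v.1 = v.2 := by
  let Φ : (Fin d → ℂ) × ℂ → ℂ := fun v => P.eval₂ (MvPolynomial.eval v.1) v.2
  have hΦ : ContDiff ℂ 1 Φ := by
    simp only [Φ, Polynomial.eval₂_eq_sum, Polynomial.sum]
    exact ContDiff.sum fun i _ =>
      ((MvPolynomial.contDiff_eval (P.coeff i)).comp contDiff_fst).mul (contDiff_snd.pow i)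
  have hat : ContDiffAt ℂ 1 Φ (z₀, y₀) := hΦ.contDiffAt
  have hder : (fderiv ℂ Φ (z₀, y₀) ∘L .inr ℂ (Fin d → ℂ) ℂ) 1 =
      P.derivative.eval₂ (MvPolynomial.eval z₀) y₀ := by
    have h1 : HasDerivAt (fun y : ℂ => Φ (z₀, y))
        ((fderiv ℂ Φ (z₀, y₀)) ((0 : Fin d → ℂ), (1 : ℂ))) y₀ :=
      ((hΦ.differentiable one_ne_zero) (z₀, y₀)).hasFDerivAt.comp_hasDerivAt y₀
        ((hasDerivAt_const y₀ z₀).prodMk (hasDerivAt_id y₀))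
    have h2 := (P.map (MvPolynomial.eval z₀)).hasDerivAt y₀
    rw [Polynomial.derivative_map, Polynomial.eval_map] at h2
    refine h1.unique (h2.congr_of_eventuallyEq (.of_forall fun y => ?_))
    simp [Φ, Polynomial.eval_map]
  have hinv : (fderiv ℂ Φ (z₀, y₀) ∘L .inr ℂ (Fin d → ℂ) ℂ).IsInvertible := by
    refine ⟨ContinuousLinearEquiv.unitsEquivAut ℂ (Units.mk0 _ h₁), ?_⟩
    ext
    rw [hder]
    simp
  refine ⟨hat.implicitFunction one_ne_zero hinv, hat.implicitFunction_apply_self one_ne_zero hinv,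
    hat.contDiffAt_implicitFunction one_ne_zero hinv, ?_, ?_⟩
  · filter_upwards [hat.eventually_apply_implicitFunction one_ne_zero hinv] with z hz
    exact hz.trans h₀
  · filter_upwards [hat.eventually_apply_eq_iff_implicitFunction one_ne_zero hinv] with v hv h
    exact hv.mp (h.trans h₀.symm)

/-! ### Vanishing ideals, dimension and local graphs -/

open MvPolynomial

theorem IsVariety.zeroLocus_vanishingIdeal {n : ℕ} {V : Set (Fin n → ℂ)} (hV : IsVariety V) :
    zeroLocus ℂ (vanishingIdeal ℂ V) = V := by
  obtain ⟨J, rfl⟩ := hV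
  exact (zeroLocus_anti_mono (le_vanishingIdeal_zeroLocus J)).antisymm
    (zeroLocus_vanishingIdeal_le _)

theorem IsVariety.inter_zeros {n : ℕ} {V : Set (Fin n → ℂ)} (hV : IsVariety V)
    (f : MvPolynomial (Fin n) ℂ) : IsVariety {x ∈ V | eval x f = 0} := by
  obtain ⟨J, rfl⟩ := hV
  refine ⟨J ⊔ Ideal.span {f}, Set.ext fun x => ⟨fun hx => ?_, fun hx => ⟨?_, ?_⟩⟩⟩
  · have : J ⊔ Ideal.span {f} ≤ RingHom.ker (eval x) :=
      sup_le (fun p hp => by simpa using hx.1 p hp)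
        ((Ideal.span_singleton_le_iff_mem _).mpr hx.2)
    exact fun p hp => this hp
  · exact zeroLocus_anti_mono le_sup_left hx
  · exact hx f (le_sup_right (a := J) (Ideal.mem_span_singleton_self f))

theorem IsIrreducibleVariety.isPrime_vanishingIdeal {n : ℕ} {V : Set (Fin n → ℂ)}
    (hV : IsIrreducibleVariety V) : (vanishingIdeal ℂ V).IsPrime := by
  obtain ⟨hvar, ⟨x, hx⟩, hirr⟩ := hV
  refine ⟨fun h => ?_, fun {f g} hfg => ?_⟩
  · have : (1 : MvPolynomial (Fin n) ℂ) ∈ vanishingIdeal ℂ V := h ▸ trivial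
    simpa using this x hx
  · have hU : V = {x ∈ V | eval x f = 0} ∪ {x ∈ V | eval x g = 0} := by
      refine Set.ext fun x => ⟨fun hx => ?_, fun hx => hx.elim And.left And.left⟩
      have h0 : eval x f * eval x g = 0 := by simpa using hfg x hx
      exact (mul_eq_zero.mp h0).imp (⟨hx, ·⟩) (⟨hx, ·⟩)
    rcases hirr _ _ (hvar.inter_zeros f) (hvar.inter_zeros g) hU with h | h
    · exact Or.inl fun x hx => (h ▸ hx : x ∈ {x ∈ V | eval x f = 0}).2
    · exact Or.inr fun x hx => (h ▸ hx : x ∈ {x ∈ V | eval x g = 0}).2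

theorem ProjFirstDominant.eq_zero_of_rename_mem {d m : ℕ} {V : Set (Fin (d + m) → ℂ)}
    (hdom : ProjFirstDominant d m V) {r : MvPolynomial (Fin d) ℂ}
    (hr : rename (Fin.castAdd m) r ∈ vanishingIdeal ℂ V) : r = 0 := by
  obtain ⟨k, hk⟩ := hdom.1
  -- The `d` coordinates chosen out of `d` are a permutation, undone by renaming `r`.
  let e : Fin d ≃ Fin d := Equiv.ofBijective k (Finite.injective_iff_bijective.mp k.injective)
  have he : ∀ i, k (e.symm i) = i := e.apply_symm_apply
  refine rename_injective _ e.symm.injective ?_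
  rw [map_zero]
  refine eq_zero_of_forall_mem_isOpen _ isOpen_interior hk fun z hz => ?_
  obtain ⟨_, ⟨x, hx, rfl⟩, rfl⟩ := interior_subset hz
  have := hr x hx
  change eval _ _ = 0 at this
  rw [eval_rename] at this
  rw [eval_rename]
  refine (congrArg (fun y => eval y r) ?_).trans this
  funext i
  simp [projFirst, he]

/-- Were these `d + 1` coordinates independent modulo the ideal, the projection of `V` to them would
contain a nonempty open set, against the maximality of `d`. -/
theorem HasComplexDim.exists_rename_snoc_mem {d m : ℕ} {V : Set (Fin (d + m) → ℂ)}
    (hV : IsIrreducibleVariety V) (hdim : HasComplexDim V d) (k : Fin m) :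
    ∃ p : MvPolynomial (Fin (d + 1)) ℂ, p ≠ 0 ∧
      rename (Fin.snoc (α := fun _ => Fin (d + m)) (Fin.castAdd m) (Fin.natAdd d k)) p ∈
        vanishingIdeal ℂ V := by
  by_contra! hcon
  have := hV.isPrime_vanishingIdeal
  let j : Fin (d + 1) → Fin (d + m) :=
    Fin.snoc (α := fun _ => Fin (d + m)) (Fin.castAdd m) (Fin.natAdd d k)
  have hj : Function.Injective j := by
    rw [Fin.snoc_injective_iff]
    refine ⟨Fin.castAdd_injective d m, ?_⟩
    rintro ⟨i, hi⟩
    have := congrArg Fin.val hi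
    simp at this
    omega
  obtain ⟨r, hr0, hr⟩ := exists_ne_zero_forall_exists_mem_zeroLocus (vanishingIdeal ℂ V) j
    fun r hr => by_contra fun h => hcon r h hr
  have hopen : IsOpen {z : Fin (d + 1) → ℂ | eval z r ≠ 0} :=
    isOpen_ne_fun (contDiff_eval (n := 0) r).continuous continuous_const
  have hmem : d + 1 ≤ d := by
    refine hdim.2 ⟨⟨j, hj⟩, ?_⟩
    have hne : {z : Fin (d + 1) → ℂ | eval z r ≠ 0}.Nonempty := by
      by_contra hempty
      refine hr0 (MvPolynomial.funext fun z => ?_)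
      by_contra hz
      exact hempty ⟨z, by simpa using hz⟩
    refine hne.mono (interior_maximal (fun z hz => ?_) hopen)
    obtain ⟨x, hx, hxz⟩ := hr z hz
    exact ⟨x, hV.1.zeroLocus_vanishingIdeal ▸ hx, hxz⟩
  omega

/-- A variety that is generically finite over the first `d` coordinates is, near each of its
points off a proper subvariety, the graph of a holomorphic map. -/
theorem exists_local_graph {d m : ℕ} {I : Ideal (MvPolynomial (Fin (d + m)) ℂ)} [I.IsPrime]
    (hinj : ∀ r : MvPolynomial (Fin d) ℂ, rename (Fin.castAdd m) r ∈ I → r = 0)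
    (hI : ∀ k : Fin m, ∃ p : MvPolynomial (Fin (d + 1)) ℂ, p ≠ 0 ∧
      rename (Fin.snoc (α := fun _ => Fin (d + m)) (Fin.castAdd m) (Fin.natAdd d k)) p ∈ I) :
    ∃ h ∉ I, ∀ p ∈ zeroLocus ℂ I, eval p h ≠ 0 → ∃ F : (Fin d → ℂ) → (Fin m → ℂ),
      (∀ k, F (projFirst d m p) k = p (Fin.natAdd d k)) ∧
      ContDiffAt ℂ 1 F (projFirst d m p) ∧
      (∀ᶠ z in 𝓝 (projFirst d m p), Fin.append z (F z) ∈ zeroLocus ℂ I) ∧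
      ∀ᶠ x in 𝓝 p, x ∈ zeroLocus ℂ I →
        ∀ k, F (projFirst d m x) k = x (Fin.natAdd d k) := by
  obtain ⟨w, P, b, q, hbP, hP, hq, hgraph⟩ := exists_generic_hypersurface hinj hI
  have heval : ∀ (x : Fin (d + m) → ℂ) (Q : Polynomial (MvPolynomial (Fin d) ℂ)),
      eval x (Q.eval₂ (rename (Fin.castAdd m) : _ →ₐ[ℂ] _).toRingHom w) =
        Q.eval₂ (eval (projFirst d m x)) (eval x w) := by
    intro x Q
    rw [Polynomial.hom_eval₂]
    congr 1
    refine MvPolynomial.ringHom_ext (fun c => by simp) fun i => by simp [projFirst]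
  have hevalb : ∀ x : Fin (d + m) → ℂ,
      eval x (rename (Fin.castAdd m) b) = eval (projFirst d m x) b := fun x => by
    rw [eval_rename]
    rfl
  -- The bad locus is cut out by `b * P'(w)`: off it, `w` is a simple root and the coordinates are
  -- `q k / b`.
  refine ⟨_, hbP, fun p hp hne => ?_⟩
  rw [map_mul, heval, hevalb] at hne
  obtain ⟨hb, hder⟩ := mul_ne_zero_iff.mp hne
  have hroot : ∀ x ∈ zeroLocus ℂ I, P.eval₂ (eval (projFirst d m x)) (eval x w) = 0 :=
    fun x hx => by simpa [← heval] using hx _ hP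
  have hcoord : ∀ x ∈ zeroLocus ℂ I, ∀ k, eval (projFirst d m x) b * x (Fin.natAdd d k) =
      (q k).eval₂ (eval (projFirst d m x)) (eval x w) := fun x hx k => by
    have := hx _ (hq k)
    change eval _ _ = 0 at this
    rw [map_sub, map_mul, hevalb, heval, eval_X] at this
    exact sub_eq_zero.mp this
  obtain ⟨f, hf0, hfd, hfroot, hfuniq⟩ := exists_local_root P (hroot p hp) hder
  have hcontp : Continuous (projFirst d m) := by
    unfold projFirst
    fun_prop
  have hbz : ∀ᶠ z in 𝓝 (projFirst d m p), eval z b ≠ 0 :=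
    (contDiff_eval (n := 0) b).continuous.continuousAt.eventually_ne hb
  refine ⟨fun z k => (q k).eval₂ (eval z) (f z) / eval z b, fun k => ?_, ?_, ?_, ?_⟩
  · beta_reduce
    rw [hf0, ← hcoord p hp, mul_div_cancel_left₀ _ hb]
  · refine contDiffAt_pi.mpr fun k => ContDiffAt.div ?_ (contDiff_eval b).contDiffAt hb
    simp only [Polynomial.eval₂_eq_sum, Polynomial.sum]
    exact ContDiffAt.sum fun i _ => (contDiff_eval _).contDiffAt.mul (hfd.pow i)
  · filter_upwards [hfroot, hbz] with z hz hz'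
    exact hgraph z (f z) hz' hz
  · have ht : Tendsto (fun x => (projFirst d m x, eval x w)) (𝓝 p)
        (𝓝 (projFirst d m p, eval p w)) :=
      (hcontp.prodMk (contDiff_eval (n := 0) w).continuous).tendsto p
    filter_upwards [ht.eventually hfuniq, hcontp.continuousAt.eventually hbz] with x hx hbx hxI k
    rw [hx (hroot x hxI), ← hcoord x hxI, mul_div_cancel_left₀ _ hbx]

/-! ### Reflection in the torus and the two implications -/

theorem conjInv_eq_self {n : ℕ} {z : Fin n → ℂ} (hz : z ∈ unitTorus n) : conjInv z = z := by
  funext i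
  rw [conjInv, ← Complex.inv_eq_conj (hz i), inv_inv]

/-- The reflection `z ↦ z*` turns polynomial equations into polynomial equations. -/
theorem exists_eval_eq_conj_eval_conjInv {n : ℕ} (q : MvPolynomial (Fin n) ℂ) :
    ∃ (N : ℕ) (q' : MvPolynomial (Fin n) ℂ), ∀ x ∈ puncturedSpace n,
      eval x q' = (∏ i, x i) ^ N * conj (eval (conjInv x) q) := by
  induction q using MvPolynomial.induction_on with
  | C c => exact ⟨0, C (conj c), fun x _ => by simp⟩
  | add p q hp hq =>
    obtain ⟨N, p', hp'⟩ := hp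
    obtain ⟨M, q', hq'⟩ := hq
    refine ⟨N + M, (∏ i, X i) ^ M * p' + (∏ i, X i) ^ N * q', fun x hx => ?_⟩
    simp only [map_add, map_mul, map_pow, map_prod, eval_X, hp' x hx, hq' x hx]
    ring
  | mul_X p i hp =>
    obtain ⟨N, p', hp'⟩ := hp
    refine ⟨N + 1, p' * ∏ j ∈ Finset.univ.erase i, X j, fun x hx => ?_⟩
    have hxi : x i ≠ 0 := hx i
    simp only [map_mul, map_prod, eval_X, hp' x hx, conjInv, map_inv₀, Complex.conj_conj,
      ← Finset.mul_prod_erase Finset.univ x (Finset.mem_univ i)]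
    field_simp
    ring

/-- The reflected equation `q'` vanishes at the torus points of `V`, which `*` fixes, hence on `V`
by density. -/
theorem ZariskiDenseIn.conjInv_mem {n : ℕ} {V : Set (Fin n → ℂ)} (hV : IsVariety V)
    (hdense : ZariskiDenseIn (V ∩ unitTorus n) V) {x : Fin n → ℂ} (hx : x ∈ V)
    (hx0 : x ∈ puncturedSpace n) : conjInv x ∈ V := by
  rw [← hV.zeroLocus_vanishingIdeal]
  intro q hq
  obtain ⟨N, q', hq'⟩ := exists_eval_eq_conj_eval_conjInv q
  have h0 : eval x q' = 0 := by
    refine hdense.2 q' (fun z hz => ?_) x hx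
    have hz0 : z ∈ puncturedSpace n := fun i =>
      norm_ne_zero_iff.mp (by rw [hz.2 i]; exact one_ne_zero)
    have hqz : eval z q = 0 := hq z hz.1
    rw [hq' z hz0, conjInv_eq_self hz.2, hqz, map_zero, mul_zero]
  rw [hq' x hx0] at h0
  have h1 := (mul_eq_zero.mp h0).resolve_left
    (pow_ne_zero _ (Finset.prod_ne_zero_iff.mpr fun i _ => hx0 i))
  exact (map_eq_zero _).mp h1

theorem ZariskiDenseIn.exists_isReflectiveGraphMap {d m : ℕ} {V : Set (Fin (d + m) → ℂ)}
    (hV : IsIrreducibleVariety V) (hdim : HasComplexDim V d) (hdom : ProjFirstDominant d m V)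
    (hdense : ZariskiDenseIn (V ∩ unitTorus (d + m)) V) :
    ∃ (U : Set (Fin d → ℂ)) (F : (Fin d → ℂ) → (Fin m → ℂ)),
      IsReflectiveGraphMap V U F ∧ (U ∩ unitTorus d).Nonempty := by
  have := hV.isPrime_vanishingIdeal
  obtain ⟨h, hh, hgraph⟩ := exists_local_graph (I := vanishingIdeal ℂ V)
    (fun r hr => hdom.eq_zero_of_rename_mem hr) (hdim.exists_rename_snoc_mem hV)
  rw [hV.1.zeroLocus_vanishingIdeal] at hgraph
  obtain ⟨p, ⟨hpV, hpT⟩, hph⟩ : ∃ p ∈ V ∩ unitTorus (d + m), eval p h ≠ 0 := by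
    by_contra! hcon
    exact hh fun x hx => hdense.2 h hcon x hx
  obtain ⟨F, hF0, hFd, hFV, huniq⟩ := hgraph p hpV hph
  set z₀ := projFirst d m p with hz₀
  have hz₀T : z₀ ∈ unitTorus d := fun i => hpT _
  have hne_of_norm : ∀ {c : ℂ}, ‖c‖ = 1 → c ≠ 0 := fun {c} hc =>
    norm_ne_zero_iff.mp (by rw [hc]; exact one_ne_zero)
  have hconj : Tendsto conjInv (𝓝 z₀) (𝓝 z₀) := by
    nth_rw 2 [← conjInv_eq_self hz₀T]
    refine tendsto_pi_nhds.mpr fun i => ?_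
    refine Tendsto.inv₀ ?_ ((map_ne_zero _).mpr (hne_of_norm (hz₀T i)))
    exact (Complex.continuous_conj.comp (continuous_apply i)).tendsto z₀
  have hpunct : ∀ᶠ z in 𝓝 z₀, z ∈ puncturedSpace d :=
    eventually_all.mpr fun i =>
      (continuous_apply i).continuousAt.eventually_ne (hne_of_norm (hz₀T i))
  have hFne : ∀ᶠ z in 𝓝 z₀, ∀ k, F z k ≠ 0 :=
    eventually_all.mpr fun k => ((continuous_apply k).continuousAt.comp
      hFd.continuousAt).eventually_ne (by
        simpa [hF0] using hne_of_norm (hpT (Fin.natAdd d k)))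
  have hFdiff : ∀ᶠ z in 𝓝 z₀, DifferentiableAt ℂ F z :=
    (hFd.eventually (by simp)).mono fun z hz => hz.differentiableAt one_ne_zero
  -- `x z` is the reflection of the graph point over `z*`. It lies in `V` and tends to `p`, so local
  -- uniqueness puts it on the graph of `F`.
  let x : (Fin d → ℂ) → (Fin (d + m) → ℂ) := fun z => Fin.append z (conjInv (F (conjInv z)))
  have hx : Tendsto x (𝓝 z₀) (𝓝 p) := by
    refine tendsto_pi_nhds.mpr fun i => ?_
    induction i using Fin.addCases with
    | left i =>
      simp only [x, Fin.append_left]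
      exact (continuous_apply i).tendsto z₀
    | right k =>
      simp only [x, Fin.append_right, conjInv]
      have h1 : p (Fin.natAdd d k) = (conj (F z₀ k))⁻¹ := by
        rw [hF0, ← Complex.inv_eq_conj (hpT _), inv_inv]
      rw [h1]
      refine Tendsto.inv₀ ?_ ((map_ne_zero _).mpr (hFne.self_of_nhds k))
      exact (Complex.continuous_conj.tendsto _).comp
        (((continuous_apply k).tendsto _).comp (hFd.continuousAt.tendsto.comp hconj))
  have hreflect : ∀ᶠ z in 𝓝 z₀, ∀ k, F z k = (conj (F (conjInv z) k))⁻¹ := by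
    filter_upwards [hx.eventually huniq, hconj.eventually hFV, hconj.eventually hFne, hpunct]
      with z hz hzV hzne hz0 k
    have hxz : x z = conjInv (Fin.append (conjInv z) (F (conjInv z))) := by
      funext i
      induction i using Fin.addCases with
      | left i => simp [x, conjInv]
      | right k => simp [x, conjInv]
    have hmem : x z ∈ V := by
      rw [hxz]
      refine hdense.conjInv_mem hV.1 hzV fun i => ?_
      induction i using Fin.addCases with
      | left i => simpa [conjInv] using hz0 i
      | right k => simpa using hzne k
    have hproj : projFirst d m (x z) = z := by
      funext i
      simp [x, projFirst]
    simpa [hproj, x, conjInv] using hz hmem k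
  obtain ⟨U, hU, hUo, hzU⟩ := eventually_nhds_iff.mp
    (hpunct.and (hFdiff.and (hFV.and (hreflect.and (hconj.eventually hFne)))))
  refine ⟨U, F, ⟨hUo, fun z hz => (hU z hz).1,
    fun z hz => (hU z hz).2.1.differentiableWithinAt, fun z hz => (hU z hz).2.2.1,
    fun z hz k => ?_⟩, z₀, hzU, hz₀T⟩
  obtain ⟨-, -, -, hr, hne⟩ := hU z hz.1
  rw [hr k, map_inv₀, Complex.conj_conj, inv_mul_cancel₀ (hne k)]

theorem IsReflectiveGraphMap.zariskiDenseIn {d m : ℕ} {V : Set (Fin (d + m) → ℂ)}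
    (hV : IsIrreducibleVariety V) (hdim : HasComplexDim V d)
    {U : Set (Fin d → ℂ)} {F : (Fin d → ℂ) → (Fin m → ℂ)} (hF : IsReflectiveGraphMap V U F)
    (hUT : (U ∩ unitTorus d).Nonempty) : ZariskiDenseIn (V ∩ unitTorus (d + m)) V := by
  refine ⟨Set.inter_subset_left, fun s hs => ?_⟩
  have := hV.isPrime_vanishingIdeal
  by_contra hcon
  obtain ⟨r, hr0, t, hrt⟩ := exists_rename_sub_mul_mem (I := vanishingIdeal ℂ V)
    (hdim.exists_rename_snoc_mem hV) (s := s) hcon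
  obtain ⟨z₀, hz₀, hz₀T⟩ := hUT
  obtain ⟨ε, hε, hball⟩ := Metric.isOpen_iff.mp hF.isOpen z₀ hz₀
  have hgraph : DifferentiableOn ℂ (fun z => Fin.append z (F z)) (Metric.ball z₀ ε) := by
    refine differentiableOn_pi.mpr fun i => ?_
    induction i using Fin.addCases with
    | left i =>
      simp only [Fin.append_left]
      exact (differentiable_apply i).differentiableOn
    | right k =>
      simp only [Fin.append_right]
      exact (differentiableOn_pi.mp hF.holomorphic k).mono hball
  have hzero : ∀ z ∈ Metric.ball z₀ ε, eval (Fin.append z (F z)) s = 0 := by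
    refine eq_zero_of_forall_mem_unitTorus hz₀T
      (((contDiff_eval (n := 1) s).differentiable one_ne_zero).comp_differentiableOn hgraph) ?_
    rintro z ⟨hz, hzT⟩
    refine hs _ ⟨hF.graph_subset z (hball hz), fun i => ?_⟩
    induction i using Fin.addCases with
    | left i => simpa using hzT i
    | right k =>
      -- At a torus point `z* = z`, so the reflection identity reads `|F z k|² = 1`.
      have h1 := hF.reflection z ⟨hball hz, z, hball hz, conjInv_eq_self hzT⟩ k
      rw [conjInv_eq_self hzT, mul_comm, Complex.mul_conj, Complex.normSq_eq_norm_sq] at h1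
      rw [Fin.append_right]
      exact (pow_eq_one_iff_of_nonneg (norm_nonneg _) two_ne_zero).mp (by exact_mod_cast h1)
  refine hr0 (r.eq_zero_of_forall_mem_isOpen
    (Metric.isOpen_ball (x := z₀) (ε := ε)) (Metric.nonempty_ball.mpr hε) fun z hz => ?_)
  have h1 := hrt _ (hF.graph_subset z (hball hz))
  change eval _ _ = 0 at h1
  rw [map_sub, map_mul, hzero z hz, zero_mul, sub_zero,
    eval_rename] at h1
  refine (congrArg (fun y => eval y r) ?_).trans h1
  funext i
  simp

theorem theorem1 (d m : ℕ) (V : Set (Fin (d + m) → ℂ))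
    (hV : IsIrreducibleVariety V) (hdim : HasComplexDim V d) (hdom : ProjFirstDominant d m V) :
    (ZariskiDenseIn (V ∩ unitTorus (d + m)) V ↔
      ∃ (U : Set (Fin d → ℂ)) (F : (Fin d → ℂ) → (Fin m → ℂ)),
        IsReflectiveGraphMap V U F ∧ (U ∩ unitTorus d).Nonempty) ∧
    (∀ (U : Set (Fin d → ℂ)) (F : (Fin d → ℂ) → (Fin m → ℂ)),
      IsReflectiveGraphMap V U F → ∀ k : Fin m, IsAlgebraicFunOn U (fun z => F z k)) := by
  refine ⟨⟨fun h => h.exists_isReflectiveGraphMap hV hdim hdom, ?_⟩, fun U F hF k => ?_⟩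
  · rintro ⟨U, F, hF, hUT⟩
    exact hF.zariskiDenseIn hV hdim hUT
  · obtain ⟨p, hp0, hp⟩ := hdim.exists_rename_snoc_mem hV k
    refine ⟨differentiableOn_pi.mp hF.holomorphic k, p, hp0, fun z hz => ?_⟩
    have h1 := hp _ (hF.graph_subset z hz)
    change eval _ _ = 0 at h1
    rw [eval_rename] at h1
    refine (congrArg (fun y => eval y p) ?_).trans h1
    funext i
    induction i using Fin.lastCases with
    | last => simp
    | cast i => simp
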